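/- Let $n\ge 2$ and let $H_n=\mathbb R^{2n+1}$ be the Heisenberg group with coordinates $(x^1,\dots,x^{2n},z)$ and multiplication $$(a,b,c)\circ(x,y,z)=\Big(a+x,\;b+y,\;c+z+\sum_{j=1}^n(b_jx_j-a_jy_j)\Big),\qquad x_j=x^j,\ y_j=x^{n+j}.$$ Its horizontal distribution has the orthonormal frame $\hat e_j=\partial_{x_j}+y_j\partial_z$, $\hat e_{n+j}=\partial_{y_j}-x_j\partial_z$ ($1\le j\le n$), and the horizontal (or $p$-)mean curvature of a level set of a function $\phi$ is $$H_\phi=\sum_{I=1}^{2n}\hat e_I\Big(\frac{\hat e_I\phi}{|d\phi|_*}\Big),\qquad |d\phi|_*=\Big(\sum_{I=1}^{2n}(\hat e_I\phi)^2\Big)^{1/2}\neq 0.$$ For a function $u=u(\eta^2,\dots,\eta^{2n},\tau)$, the intrinsic graph of $u$ is the hypersurface of points $(0,\eta^2,\dots,\eta^{2n},\tau)\circ(u(\eta^2,\dots,\eta^{2n},\tau),0,\dots,0)$, that is, $x^1=u$, $x^j=\eta^j$ for $2\le j\le 2n$, and $z=\tau+\eta^{n+1}u$. Its horizontal mean curvature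 is that of the zero set of the defining function $u(x^2,\dots,x^{2n},z-x^1x^{n+1})-x^1$. Let $W^u=(\mathring e_2,\dots,\mathring e_n,\mathring e^u_{n+1},\mathring e_{n+2},\dots,\mathring e_{2n})$, where $$\mathring e_j=\partial_{\eta^j}+\eta^{n+j}\partial_\tau,\qquad \mathring e_{n+j}=\partial_{\eta^{n+j}}-\eta^j\partial_\tau\quad(2\le j\le n),\qquad \mathring e^u_{n+1}=\partial_{\eta^{n+1}}-2u\,\partial_\tau .$$ **Theorem E.** Let $u$ and $v$ be $C^\infty$ functions of $(\eta^2,\dots,\eta^{2n},\tau)$ on an open neighborhood $U$ of a point $p_0\in\mathbb R^{2n}$. Assume that $v(p_0)=u(p_0)$, that $v_{\eta^{n+1}}(p_0)\ne 0$ and $u_{\eta^{n+1}}(p_0)\neq 0$, that $v\ge u$ in $U$, and that $$W^v\cdot\left(\frac{W^v(v)}{\sqrt{1+|W^v(v)|^2}}\right)\;\le\; W^u\cdot\left(\frac{W^u(u)}{\sqrt{1+|W^u(u)|^2}}\right)\qquad\text{in } U.$$ If the intrinsic graph of $v$ or the intrinsic graph of $u$ (over $U$) has constant horizontal mean curvature,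 then $v\equiv u$ in a neighborhood of $p_0$. -/

import Mathlib

open scoped ContDiff Topology

noncomputable section

/-- Points `(x_1, …, x_n, y_1, …, y_n, z)` of the Heisenberg group `H_n`
(`x_j = x^j`, `y_j = x^{n+j}`). -/
abbrev Heis (n : ℕ) : Type := (Fin n → ℝ) × (Fin n → ℝ) × ℝ

namespace Heis

variable {n : ℕ}

/-- The group multiplication
`(a, b, c) ∘ (x, y, z) = (a + x, b + y, c + z + ∑ (b_j x_j - a_j y_j))`. -/
def mul (p q : Heis n) : Heis n :=
  (p.1 + q.1, p.2.1 + q.2.1,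
    p.2.2 + q.2.2 + ∑ j, (p.2.1 j * q.1 j - p.1 j * q.2.1 j))

/-- The left-invariant orthonormal frame of the contact distribution:
`∂/∂x_j + y_j ∂/∂z` (index `inl j`) and `∂/∂y_j - x_j ∂/∂z` (index `inr j`). -/
def frame : Fin n ⊕ Fin n → Heis n → Heis n
  | Sum.inl j, p => (Pi.single j 1, 0, p.2.1 j)
  | Sum.inr j, p => (0, Pi.single j 1, -p.1 j)

/-- The derivative of `φ` along the `I`-th horizontal frame field. -/
def D (I : Fin n ⊕ Fin n) (φ : Heis n → ℝ) (p : Heis n) : ℝ :=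
  fderiv ℝ φ p (frame I p)

/-- The length `|dφ|_*` with respect to the subriemannian metric of `H_n`, that is, the length of
the subgradient of `φ`. -/
def normD (φ : Heis n → ℝ) (p : Heis n) : ℝ :=
  Real.sqrt (∑ I, D I φ p ^ 2)

/-- The horizontal (or p-)mean curvature `H_φ = div_b (∇_b φ / |∇_b φ|)` of the level sets of `φ`.
As the frame fields are divergence free for the volume form
`dx_1 ∧ … ∧ dx_n ∧ dy_1 ∧ … ∧ dy_n ∧ Θ`, this is the divergence of the horizontal unit normal. -/
def meanCurvature (φ : Heis n → ℝ) (p : Heis n) : ℝ :=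
  ∑ I, D I (fun q => D I φ q / normD φ q) p

end Heis

/-- The parameters `(η^2, …, η^n; η^{n+1}, …, η^{2n}; τ)` of an intrinsic graph in `H_n`,
`n = m + 1`.  With indices starting at `0`, `η^{j+2}` is `p.1 j` for `j < m`, and `η^{n+1+k}` is
`p.2.1 k` for `k < m + 1`. -/
abbrev GraphParam (m : ℕ) : Type := (Fin m → ℝ) × (Fin (m + 1) → ℝ) × ℝ

namespace IntrinsicGraph

variable {m : ℕ}

/-- The point `(0, η^2, …, η^{2n}, τ) ∘ (u(η, τ), 0, …, 0)` of the intrinsic graph of `u`. -/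
def point (u : GraphParam m → ℝ) (p : GraphParam m) : Heis (m + 1) :=
  Heis.mul (Fin.cons 0 p.1, p.2.1, p.2.2) (Pi.single 0 (u p), 0, 0)

/-- The parameters `η^j = x^j` (`2 ≤ j ≤ 2n`), `τ = z - x^{n+1} x^1` of a point of `H_n`. -/
def param (q : Heis (m + 1)) : GraphParam m :=
  (Fin.tail q.1, q.2.1, q.2.2 - q.2.1 0 * q.1 0)

/-- The defining function `u(η^2, …, η^{2n}, τ) - x^1` of the intrinsic graph of `u`. -/
def definingFunction (u : GraphParam m → ℝ) (q : Heis (m + 1)) : ℝ :=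
  u (param q) - q.1 0

/-- The intrinsic graph of `u` over `U` has constant horizontal (or p-)mean curvature. -/
def HasConstantMeanCurvature (u : GraphParam m → ℝ) (U : Set (GraphParam m)) : Prop :=
  ∃ c : ℝ, ∀ p ∈ U, Heis.meanCurvature (definingFunction u) (point u p) = c

/-- The vector fields that make up `W^u`: for `2 ≤ j ≤ n`, `∂/∂η^j + η^{n+j} ∂/∂τ`; then
`∂/∂η^{n+1} - 2 u ∂/∂τ`; then, for `2 ≤ j ≤ n`, `∂/∂η^{n+j} - η^j ∂/∂τ`. -/
def field (u : GraphParam m → ℝ) : Fin m ⊕ Fin (m + 1) → GraphParam m → GraphParam m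
  | Sum.inl j, p => (Pi.single j 1, 0, p.2.1 j.succ)
  | Sum.inr k, p =>
      (0, Pi.single k 1, (Fin.cons (-2 * u p) (fun j => -p.1 j) : Fin (m + 1) → ℝ) k)

/-- The `i`-th component of `W^u(f)`. -/
def W (u : GraphParam m → ℝ) (i : Fin m ⊕ Fin (m + 1)) (f : GraphParam m → ℝ)
    (p : GraphParam m) : ℝ :=
  fderiv ℝ f p (field u i p)

/-- `W^u · (W^u(u) / √(1 + |W^u(u)|²))`. -/
def curvatureOp (u : GraphParam m → ℝ) (p : GraphParam m) : ℝ :=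
  ∑ i, W u i (fun q => W u i u q / Real.sqrt (1 + ∑ k, W u k u q ^ 2)) p

/-- The partial derivative `u_{η^{n+1}}`. -/
def partialEta (u : GraphParam m → ℝ) (p : GraphParam m) : ℝ :=
  fderiv ℝ u p (0, Pi.single 0 1, 0)

end IntrinsicGraph

end

/-! The proof follows Bony's strong maximum principle for degenerate elliptic equations, applied to
the contact set Z = {v = u}, which is closed in U. `curvatureOp` is affine in the second derivative,
and its leading part only sees the fields X_i of W^u. On Z these agree with the fields of W^v,
because they depend on the function only through its value.

Hopf's lemma (`leading_part_fderiv_smulRight_nonpos`) shows that every normal to Z annihilates all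
X_i, so that the X_i are tangent to Z in Bony's sense. A tangent field with straight integral curves
leaves Z invariant (`isFlowInvariantAt_of_isTangentAt`). For n ≥ 2 there is a pair ∂_{η^j} +
η^{n+j}∂_τ, ∂_{η^{n+j}} - η^j∂_τ whose coefficients do not involve u. Its commutator is a nonzero
multiple of ∂_τ, so ∂_τ is tangent too (`isTangentAt_vertical`). Subtracting multiples of ∂_τ from
the X_i makes all directions tangent. A closed set without normals is open
(`eventually_mem_of_isTangentAt`), so Z is a neighborhood of p₀. -/

noncomputable section

/-! ### Hopf's lemma for degenerate quasilinear operators -/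

section HopfLemma

variable {E : Type*} [NormedAddCommGroup E] [NormedSpace ℝ E]

/-- The second derivative is positive semidefinite at a local minimum. -/
theorem IsLocalMin.fderiv_fderiv_nonneg {f : E → ℝ} {p : E} (hf : ContDiffAt ℝ 2 f p)
    (hmin : IsLocalMin f p) (y : E) : 0 ≤ fderiv ℝ (fderiv ℝ f) p y y := by
  set l : ℝ → E := fun t => p + t • y with hl
  have hl0 : l 0 = p := by simp [hl]
  have hld : ∀ t, HasDerivAt l y t := fun t => by
    simpa [hl] using ((hasDerivAt_id t).smul_const y).const_add p
  have hlc : Continuous l := by fun_prop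
  have htend : Filter.Tendsto l (𝓝 0) (𝓝 p) := by simpa [hl0] using hlc.tendsto 0
  have hder : deriv (f ∘ l) =ᶠ[𝓝 0] fun t => fderiv ℝ f (l t) y := by
    have h1 : ∀ᶠ q in 𝓝 p, DifferentiableAt ℝ f q :=
      (hf.eventually (by simp)).mono fun q hq => hq.differentiableAt (by simp)
    filter_upwards [htend.eventually h1] with t ht
    exact (ht.hasFDerivAt.comp_hasDerivAt t (hld t)).deriv
  have hd2 : HasDerivAt (fun t => fderiv ℝ f (l t) y) (fderiv ℝ (fderiv ℝ f) p y y) 0 := by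
    have h1 : DifferentiableAt ℝ (fderiv ℝ f) (l 0) := by
      rw [hl0]
      exact (hf.fderiv_right (m := 1) (by norm_num)).differentiableAt (by simp)
    have h2 := (h1.hasFDerivAt.comp_hasDerivAt 0 (hld 0)).clm_apply (hasDerivAt_const 0 y)
    simpa [hl0] using h2
  have hdd : deriv (deriv (f ∘ l)) 0 = fderiv ℝ (fderiv ℝ f) p y y := by
    rw [hder.deriv_eq, hd2.deriv]
  by_contra hneg
  push Not at hneg
  have hmin0 : IsLocalMin (f ∘ l) 0 := by
    have := htend.eventually hmin
    filter_upwards [this] with t ht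
    simpa [hl0] using ht
  have hd0 : deriv (f ∘ l) 0 = 0 := hmin0.deriv_eq_zero
  have hcont : ContinuousAt (f ∘ l) 0 :=
    ContinuousAt.comp (by rw [hl0]; exact hf.continuousAt) hlc.continuousAt
  -- A negative second derivative would make 0 a local maximum as well, so `f ∘ l` would be locally
  -- constant.
  have hmax : IsLocalMax (f ∘ l) 0 :=
    isLocalMax_of_deriv_deriv_neg (by rw [hdd]; exact hneg) hd0 hcont
  have hconst : (f ∘ l) =ᶠ[𝓝 0] fun _ => (f ∘ l) 0 := by
    filter_upwards [hmin0, hmax] with t h1 h2 using le_antisymm h2 h1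
  have : deriv (deriv (f ∘ l)) 0 = 0 := by
    rw [hconst.deriv.deriv_eq]
    simp
  rw [hdd] at this
  linarith

variable [FiniteDimensional ℝ E]

/-- Comparison with a barrier `h` for a degenerate elliptic equation `F (p, u, Du) (D²u)` which is
affine in the second derivative with leading part `G`. -/
theorem exists_leading_part_barrier_le
    {F G : E × ℝ × (E →L[ℝ] ℝ) → (E →L[ℝ] E →L[ℝ] ℝ) → ℝ}
    (hFG : ∀ x M N, F x (M + N) = F x M + G x N)
    (hGpos : ∀ x N, (∀ y, 0 ≤ N y y) → 0 ≤ G x N)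
    (hGadd : ∀ x M N, G x (M + N) = G x M + G x N)
    (hGsmul : ∀ x (c : ℝ) M, G x (c • M) = c * G x M)
    (hGcont : Continuous (Function.uncurry G))
    (hF : ContDiff ℝ 1 (Function.uncurry F))
    {U : Set E} (hU : IsOpen U) {u v : E → ℝ} (hu : ContDiffOn ℝ 2 u U)
    (hv : ContDiffOn ℝ 2 v U) (hle : ∀ p ∈ U, u p ≤ v p)
    (hQ : ∀ p ∈ U, F (p, v p, fderiv ℝ v p) (fderiv ℝ (fderiv ℝ v) p) ≤
      F (p, u p, fderiv ℝ u p) (fderiv ℝ (fderiv ℝ u) p))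
    {z : E} (hz : z ∈ U) (huv : v z = u z) :
    ∃ C : ℝ, ∀ h : E → ℝ, ContDiff ℝ 2 h → h z = 0 → fderiv ℝ h z ≠ 0 →
      (∀ᶠ y in 𝓝 z, v y = u y → y ≠ z → h y < 0) →
      G (z, u z, fderiv ℝ u z) (fderiv ℝ (fderiv ℝ h) z) ≤ C * ‖fderiv ℝ h z‖ := by
  obtain ⟨K, s, hs, hK⟩ := (hF.contDiffAt
    (x := ((z, u z, fderiv ℝ u z), fderiv ℝ (fderiv ℝ u) z))).exists_lipschitzOnWith
  -- The constant is a Lipschitz constant of `F` near the 2-jet of u at z. It does not depend on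
  -- `h`, so barriers may be rescaled later.
  refine ⟨K, fun h hh hhz hDh hneg => ?_⟩
  by_contra! hlt
  have cu : ∀ p ∈ U, ContDiffAt ℝ 2 u p := fun p hp => hu.contDiffAt (hU.mem_nhds hp)
  have cv : ∀ p ∈ U, ContDiffAt ℝ 2 v p := fun p hp => hv.contDiffAt (hU.mem_nhds hp)
  have cDu : ∀ p ∈ U, ContDiffAt ℝ 1 (fderiv ℝ u) p := fun p hp =>
    (cu p hp).fderiv_right (by norm_num)
  have cDv : ∀ p ∈ U, ContDiffAt ℝ 1 (fderiv ℝ v) p := fun p hp =>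
    (cv p hp).fderiv_right (by norm_num)
  have cDh : ContDiff ℝ 1 (fderiv ℝ h) := hh.fderiv_right (by norm_num)
  have cDDh : Continuous (fderiv ℝ (fderiv ℝ h)) := cDh.continuous_fderiv (by simp)
  have kDDu : ContinuousAt (fderiv ℝ (fderiv ℝ u)) z :=
    ((cDu z hz).fderiv_right (m := 0) (by norm_num)).continuousAt
  have kDu := (cDu z hz).continuousAt
  have ku := (cu z hz).continuousAt
  have kv := (cv z hz).continuousAt
  have kfst : ContinuousAt (Prod.fst : E × ℝ → E) (z, 0) := continuousAt_fst
  have k2 : ContinuousAt (fun q : E × ℝ => ((q.1, v q.1, fderiv ℝ u q.1 + q.2 • fderiv ℝ h q.1) :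
      E × ℝ × (E →L[ℝ] ℝ))) (z, 0) :=
    kfst.prodMk ((ContinuousAt.fst'' kv).prodMk ((ContinuousAt.fst'' kDu).add
      (continuousAt_snd.smul (ContinuousAt.fst'' cDh.continuous.continuousAt))))
  have e1 : ∀ᶠ q : E × ℝ in 𝓝 (z, 0),
      (((q.1, u q.1, fderiv ℝ u q.1), fderiv ℝ (fderiv ℝ u) q.1) :
        (E × ℝ × (E →L[ℝ] ℝ)) × (E →L[ℝ] E →L[ℝ] ℝ)) ∈ s :=
    ((kfst.prodMk ((ContinuousAt.fst'' ku).prodMk (ContinuousAt.fst'' kDu))).prodMk (ContinuousAt.fst'' kDDu)).eventually_mem (by simpa using hs)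
  have e2 : ∀ᶠ q : E × ℝ in 𝓝 (z, 0),
      (((q.1, v q.1, fderiv ℝ u q.1 + q.2 • fderiv ℝ h q.1), fderiv ℝ (fderiv ℝ u) q.1) :
        (E × ℝ × (E →L[ℝ] ℝ)) × (E →L[ℝ] E →L[ℝ] ℝ)) ∈ s :=
    (k2.prodMk (ContinuousAt.fst'' kDDu)).eventually_mem (by simpa [huv] using hs)
  have e3 : ∀ᶠ q : E × ℝ in 𝓝 (z, 0), K * max (h q.1) ‖fderiv ℝ h q.1‖ <
      G (q.1, v q.1, fderiv ℝ u q.1 + q.2 • fderiv ℝ h q.1) (fderiv ℝ (fderiv ℝ h) q.1) := by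
    refine ContinuousAt.eventually_lt ?_
      (hGcont.continuousAt.comp' (k2.prodMk (ContinuousAt.fst'' cDDh.continuousAt))) ?_
    · exact continuousAt_const.mul ((ContinuousAt.fst'' hh.continuous.continuousAt).max
        (ContinuousAt.fst'' cDh.continuous.continuousAt).norm)
    · simpa [huv, hhz] using hlt
  have e4 : ∀ᶠ q : E × ℝ in 𝓝 (z, 0), q.1 ∈ U ∧ (v q.1 = u q.1 → q.1 ≠ z → h q.1 < 0) :=
    kfst.eventually ((hU.eventually_mem hz).and hneg)
  have eall := e1.and (e2.and (e3.and e4))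
  rw [nhds_prod_eq, Filter.eventually_prod_iff] at eall
  obtain ⟨pa, hpa, pb, hpb, hab⟩ := eall
  obtain ⟨R, hR, hRa⟩ := Metric.nhds_basis_closedBall.eventually_iff.1 hpa
  set B := Metric.closedBall z R with hB
  have hBU : ∀ p ∈ B, p ∈ U := fun p hp => (hab (hRa hp) hpb.self_of_nhds).2.2.2.1
  have hBneg : ∀ p ∈ B, v p = u p → p ≠ z → h p < 0 := fun p hp =>
    (hab (hRa hp) hpb.self_of_nhds).2.2.2.2
  have hS : IsCompact (Metric.sphere z R ∩ {p | 0 ≤ h p}) :=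
    (isCompact_sphere z R).inter_right (isClosed_le continuous_const hh.continuous)
  -- Contact points on the sphere have h < 0, so v - u is positive on the compact part where h ≥ 0
  -- and dominates εh there for small ε.
  have hsph : ∀ᶠ ε : ℝ in 𝓝 0, ∀ p ∈ Metric.sphere z R ∩ {p | 0 ≤ h p},
      ε * h p < v p - u p := by
    refine hS.eventually_forall_of_forall_eventually fun p hp => ?_
    have hpB : p ∈ B := Metric.sphere_subset_closedBall hp.1
    have hpU := hBU p hpB
    have hpz : p ≠ z := by
      rintro rfl
      have := hp.1
      simp at this
      exact hR.ne this
    have hpos : u p < v p := lt_of_le_of_ne (hle p hpU) fun heq =>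
      absurd (hBneg p hpB heq.symm hpz) (not_lt.2 hp.2)
    have ksnd : ContinuousAt (Prod.snd : ℝ × E → E) (0, p) := continuousAt_snd
    refine ContinuousAt.eventually_lt ?_ ?_ ?_
    · exact continuousAt_fst.mul (hh.continuous.continuousAt.comp' ksnd)
    · exact ((cv p hpU).continuousAt.comp' ksnd).sub ((cu p hpU).continuousAt.comp' ksnd)
    · simpa using hpos
  obtain ⟨ε, ⟨hεb, hεs⟩, hε⟩ : ∃ ε : ℝ, (pb ε ∧ ∀ p ∈ Metric.sphere z R ∩ {p | 0 ≤ h p},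
      ε * h p < v p - u p) ∧ 0 < ε := by
    have h1 : ∀ᶠ ε : ℝ in 𝓝[>] 0, _ := (hpb.and hsph).filter_mono nhdsWithin_le_nhds
    exact (h1.and self_mem_nhdsWithin).exists
  set f : E → ℝ := fun p => v p - u p - ε * h p with hf
  have hfcont : ContinuousOn f B := ((hv.continuousOn.mono hBU).sub
    (hu.continuousOn.mono hBU)).sub (continuous_const.mul hh.continuous).continuousOn
  have hzB : z ∈ B := Metric.mem_closedBall_self hR.le
  obtain ⟨p, hpB, hpmin⟩ := (isCompact_closedBall z R).exists_isMinOn ⟨z, hzB⟩ hfcont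
  have hpU := hBU p hpB
  have hDf : ∀ q ∈ U, fderiv ℝ f q = fderiv ℝ v q - fderiv ℝ u q - ε • fderiv ℝ h q := by
    intro q hq
    have a1 := ((cv q hq).differentiableAt (by simp)).hasFDerivAt
    have a2 := ((cu q hq).differentiableAt (by simp)).hasFDerivAt
    have a3 := ((hh.differentiable (by simp)) q).hasFDerivAt
    exact ((a1.sub a2).sub (a3.const_mul ε)).fderiv
  rcases lt_or_ge (f p) 0 with hfp | hfp
  -- A negative minimum of f = v - u - εh is interior. There D²f ≥ 0, and the Lipschitz bound
  -- contradicts `e3`.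
  · have hball : p ∈ Metric.ball z R := by
      rcases (Metric.mem_closedBall.1 hpB).lt_or_eq with h1 | h1
      · exact h1
      · exfalso
        rcases le_or_gt 0 (h p) with h2 | h2
        · have := hεs p ⟨h1, h2⟩
          simp only [hf] at hfp
          linarith
        · have := hle p hpU
          have := mul_neg_of_pos_of_neg hε h2
          simp only [hf] at hfp
          linarith
    have hloc : IsLocalMin f p := hpmin.isLocalMin
      (Filter.mem_of_superset (Metric.isOpen_ball.mem_nhds hball) Metric.ball_subset_closedBall)
    have hfC : ContDiffAt ℝ 2 f p :=
      ((cv p hpU).sub (cu p hpU)).sub (contDiffAt_const.mul hh.contDiffAt)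
    have hD0 : fderiv ℝ v p = fderiv ℝ u p + ε • fderiv ℝ h p := by
      have := hDf p hpU
      rw [hloc.fderiv_eq_zero] at this
      rw [eq_comm, sub_sub, sub_eq_zero] at this
      exact this
    have hDD : fderiv ℝ (fderiv ℝ v) p = fderiv ℝ (fderiv ℝ u) p +
        (ε • fderiv ℝ (fderiv ℝ h) p + fderiv ℝ (fderiv ℝ f) p) := by
      have h1 : fderiv ℝ f =ᶠ[𝓝 p] fun q => fderiv ℝ v q - fderiv ℝ u q - ε • fderiv ℝ h q := by
        filter_upwards [hU.mem_nhds hpU] with q hq using hDf q hq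
      have a1 := ((cDv p hpU).differentiableAt (by simp)).hasFDerivAt
      have a2 := ((cDu p hpU).differentiableAt (by simp)).hasFDerivAt
      have a3 := ((cDh.differentiable (by simp)) p).hasFDerivAt
      have a4 : fderiv ℝ (fderiv ℝ f) p = _ :=
        h1.fderiv_eq.trans ((a1.sub a2).sub (a3.const_smul ε)).fderiv
      rw [a4]
      abel
    obtain ⟨m1, m2, m3, -⟩ := hab (hRa hpB) hεb
    dsimp only at m1 m2 m3
    have hq := hQ p hpU
    rw [hDD, hD0, hFG, hGadd, hGsmul] at hq
    have hN := hGpos (p, v p, fderiv ℝ u p + ε • fderiv ℝ h p) _ fun y =>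
      hloc.fderiv_fderiv_nonneg hfC y
    have hL := hK.dist_le_mul _ m1 _ m2
    simp only [Function.uncurry, Real.dist_eq, Prod.dist_eq, dist_self, dist_self_add_right,
      norm_smul, Real.norm_eq_abs] at hL
    have hw : |u p - v p| ≤ ε * h p := by
      rw [abs_sub_comm, abs_of_nonneg (by linarith [hle p hpU])]
      simp only [hf] at hfp
      linarith
    have hmax : max (max 0 (max |u p - v p| (|ε| * ‖fderiv ℝ h p‖))) 0 ≤
        ε * max (h p) ‖fderiv ℝ h p‖ := by
      have b1 : ε * h p ≤ ε * max (h p) ‖fderiv ℝ h p‖ := by gcongr; exact le_max_left _ _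
      have b2 : ε * ‖fderiv ℝ h p‖ ≤ ε * max (h p) ‖fderiv ℝ h p‖ := by
        gcongr; exact le_max_right _ _
      have b0 : 0 ≤ ε * ‖fderiv ℝ h p‖ := by positivity
      rw [abs_of_pos hε]
      exact max_le (max_le (b0.trans b2) (max_le (hw.trans b1) b2)) (b0.trans b2)
    have hL2 := (le_abs_self _).trans (hL.trans (mul_le_mul_of_nonneg_left hmax K.2))
    have hm := mul_lt_mul_of_pos_left m3 hε
    change _ ≤ (K : ℝ) * _ at hL2
    linarith
  -- Otherwise both f and v - u have a local minimum at z, which forces Dh(z) = 0.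
  · have hfz : f z = 0 := by simp [hf, huv, hhz]
    have hBn : B ∈ 𝓝 z := Metric.closedBall_mem_nhds z hR
    have hlocf : IsLocalMin f z := by
      filter_upwards [hBn] with q hq
      rw [hfz]
      exact hfp.trans (hpmin hq)
    have hlocw : IsLocalMin (fun p => v p - u p) z := by
      filter_upwards [hBn] with q hq
      have := hle q (hBU q hq)
      rw [huv]
      linarith
    have d1 := hlocf.fderiv_eq_zero
    have d2 := (((cv z hz).differentiableAt (by simp)).hasFDerivAt.sub
      ((cu z hz).differentiableAt (by simp)).hasFDerivAt).fderiv.symm.trans hlocw.fderiv_eq_zero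
    rw [hDf z hz] at d1
    rw [d2, zero_sub, neg_eq_zero, smul_eq_zero] at d1
    exact d1.elim hε.ne' hDh

/-- Hopf's lemma: a function whose restriction to the coincidence set has a local minimum at `z`
has no leading part in its direction of steepest descent. -/
theorem leading_part_fderiv_smulRight_nonpos
    {F G : E × ℝ × (E →L[ℝ] ℝ) → (E →L[ℝ] E →L[ℝ] ℝ) → ℝ}
    (hFG : ∀ x M N, F x (M + N) = F x M + G x N)
    (hGpos : ∀ x N, (∀ y, 0 ≤ N y y) → 0 ≤ G x N)
    (hGadd : ∀ x M N, G x (M + N) = G x M + G x N)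
    (hGsmul : ∀ x (c : ℝ) M, G x (c • M) = c * G x M)
    (hGcont : Continuous (Function.uncurry G))
    (hF : ContDiff ℝ 1 (Function.uncurry F))
    {U : Set E} (hU : IsOpen U) {u v : E → ℝ} (hu : ContDiffOn ℝ 2 u U)
    (hv : ContDiffOn ℝ 2 v U) (hle : ∀ p ∈ U, u p ≤ v p)
    (hQ : ∀ p ∈ U, F (p, v p, fderiv ℝ v p) (fderiv ℝ (fderiv ℝ v) p) ≤
      F (p, u p, fderiv ℝ u p) (fderiv ℝ (fderiv ℝ u) p))
    {z : E} (hz : z ∈ U) (huv : v z = u z) {g : E → ℝ} (hg : ContDiff ℝ 2 g)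
    (hmin : ∀ᶠ y in 𝓝 z, v y = u y → g z ≤ g y) :
    G (z, u z, fderiv ℝ u z) ((fderiv ℝ g z).smulRight (fderiv ℝ g z)) ≤ 0 := by
  obtain ⟨C, hC⟩ := exists_leading_part_barrier_le hFG hGpos hGadd hGsmul hGcont hF hU hu hv hle
    hQ hz huv
  set x : E × ℝ × (E →L[ℝ] ℝ) := (z, u z, fderiv ℝ u z) with hx
  by_contra! hpos
  have hDg : fderiv ℝ g z ≠ 0 := by
    intro h0
    have : G x 0 = 0 := by
      have h1 := hGsmul x 2 0
      have h2 : (2 : ℝ) • (0 : E →L[ℝ] E →L[ℝ] ℝ) = 0 := by ext; simp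
      rw [h2] at h1
      linarith
    rw [h0, ContinuousLinearMap.smulRight_zero, this] at hpos
    exact hpos.false
  -- This term makes the barrier strictly negative at contact points other than z without changing
  -- its gradient at z. The Euclidean norm is used for smoothness.
  let κ : E → ℝ := fun y => ‖toEuclidean (y - z)‖ ^ 2
  have hκ : ContDiff ℝ 2 κ :=
    (toEuclidean.contDiff.comp (contDiff_id.sub contDiff_const)).norm_sq ℝ
  have hκz : κ z = 0 := by simp [κ]
  have hκpos : ∀ y, y ≠ z → 0 < κ y := fun y hy => by
    have : toEuclidean (y - z) ≠ 0 := by simpa [sub_eq_zero] using hy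
    positivity
  have hDκ : fderiv ℝ κ z = 0 := by
    refine IsLocalMin.fderiv_eq_zero (Filter.Eventually.of_forall fun y => ?_)
    rw [hκz]
    positivity
  have hDiff : Differentiable ℝ g := hg.differentiable (by simp)
  have hDg1 : ContDiff ℝ 1 (fderiv ℝ g) := hg.fderiv_right (by norm_num)
  have hDκ1 : ContDiff ℝ 1 (fderiv ℝ κ) := hκ.fderiv_right (by norm_num)
  set M : E →L[ℝ] E →L[ℝ] ℝ := fderiv ℝ (fderiv ℝ g) z + fderiv ℝ (fderiv ℝ κ) z with hM
  -- The gradient of the barrier at z is -Dg(z) for every c, while its leading part grows linearly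
  -- in c. A large c is then contradictory.
  have key : ∀ c : ℝ, 0 < c →
      c * G x ((fderiv ℝ g z).smulRight (fderiv ℝ g z)) + (-1) * G x M ≤ C * ‖fderiv ℝ g z‖ := by
    intro c hc
    let h : E → ℝ := fun y => c / 2 * (g y - g z) ^ 2 - (g y - g z) - κ y
    have hD : fderiv ℝ h = fun y => (c * (g y - g z)) • fderiv ℝ g y - fderiv ℝ g y -
        fderiv ℝ κ y := by
      funext y
      have a1 := (hDiff y).hasFDerivAt.sub_const (g z)
      have a2 := ((hκ.differentiable (by simp)) y).hasFDerivAt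
      have a3 := (((a1.pow 2).const_mul (c / 2)).sub a1).sub a2
      refine a3.fderiv.trans ?_
      ext w
      simp
      ring
    have hDz : fderiv ℝ h z = -fderiv ℝ g z := by
      rw [hD]
      simp [hDκ]
    have hDD : fderiv ℝ (fderiv ℝ h) z =
        c • ((fderiv ℝ g z).smulRight (fderiv ℝ g z)) + (-1 : ℝ) • M := by
      rw [hD]
      have a1 := (hDiff z).hasFDerivAt.sub_const (g z)
      have a2 := ((hDg1.differentiable (by simp)) z).hasFDerivAt
      have a3 := ((hDκ1.differentiable (by simp)) z).hasFDerivAt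
      refine ((((a1.const_mul c).smul a2).sub a2).sub a3).fderiv.trans ?_
      ext w w'
      simp [hM]
      ring
    have := hC h ?_ ?_ ?_ ?_
    · rwa [hDD, hDz, hGadd, hGsmul, hGsmul, norm_neg] at this
    · exact ((contDiff_const.mul ((hg.sub contDiff_const).pow 2)).sub
        (hg.sub contDiff_const)).sub hκ
    · simp [h, hκz]
    · rw [hDz]
      simpa using hDg
    · have hsmall : ∀ᶠ y in 𝓝 z, g y - g z < 2 / c := by
        refine (hDiff.continuous.sub continuous_const).continuousAt.eventually_lt
          continuousAt_const ?_
        simpa using by positivity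
      filter_upwards [hsmall, hmin] with y h1 h2 h3 h4
      have h5 := h2 h3
      have h6 := hκpos y h4
      have h7 : c * (g y - g z) ≤ 2 := by
        rw [lt_div_iff₀ hc] at h1
        linarith
      -- With s = g y - g z, the barrier is -s(2 - cs)/2 - κ.
      have h8 : 0 ≤ (g y - g z) * (2 - c * (g y - g z)) :=
        mul_nonneg (by linarith) (by linarith)
      simp only [h]
      nlinarith
  set a := G x ((fderiv ℝ g z).smulRight (fderiv ℝ g z))
  have h1 := key ((|C * ‖fderiv ℝ g z‖ + G x M| + 1) / a) (by positivity)
  rw [div_mul_cancel₀ _ hpos.ne'] at h1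
  linarith [le_abs_self (C * ‖fderiv ℝ g z‖ + G x M)]

end HopfLemma
-- Tangent fields, invariance under flows and commutators
section TangentFields

variable {E : Type*} [NormedAddCommGroup E] [NormedSpace ℝ E]

/-- `V` is orthogonal at `z` to every normal of `Z` that is the gradient of a `C²` function whose
restriction to `Z` has a local minimum at `z`. -/
def IsTangentAt (Z : Set E) (z V : E) : Prop :=
  ∀ g : E → ℝ, ContDiff ℝ 2 g → (∀ᶠ y in 𝓝 z, y ∈ Z → g z ≤ g y) → fderiv ℝ g z V = 0

/-- Near `p`, `Z` is invariant under the forward flow of the vector field `y ↦ e + β y • T`, whose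
integral curves are straight lines if `β e = β T = 0`. -/
def IsFlowInvariantAt (Z : Set E) (T e : E) (β : E →L[ℝ] ℝ) (p : E) : Prop :=
  ∀ᶠ q : E × ℝ in 𝓝 (p, 0), q.1 ∈ Z → 0 ≤ q.2 → q.1 + q.2 • (e + β q.1 • T) ∈ Z

theorem IsTangentAt.add {Z : Set E} {z V V' : E} (h : IsTangentAt Z z V)
    (h' : IsTangentAt Z z V') : IsTangentAt Z z (V + V') := fun g hg hm => by
  rw [map_add, h g hg hm, h' g hg hm, add_zero]

theorem IsTangentAt.smul {Z : Set E} {z V : E} (h : IsTangentAt Z z V) (c : ℝ) :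
    IsTangentAt Z z (c • V) := fun g hg hm => by
  rw [map_smul, h g hg hm, smul_zero]

theorem IsTangentAt.sum {ι : Type*} {Z : Set E} {z : E} {V : ι → E} (s : Finset ι)
    (h : ∀ i ∈ s, IsTangentAt Z z (V i)) : IsTangentAt Z z (∑ i ∈ s, V i) := fun g hg hm => by
  rw [map_sum, Finset.sum_eq_zero fun i hi => h i hi g hg hm]

/-- The commutator of two flows with straight integral curves moves points in the direction `T`. -/
theorem IsFlowInvariantAt.eventually_add_smul_mem {Z : Set E} {T e₁ e₂ z : E}
    {β₁ β₂ : E →L[ℝ] ℝ} (h11 : β₁ e₁ = 0) (h22 : β₂ e₂ = 0) (h1T : β₁ T = 0) (h2T : β₂ T = 0)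
    (hf₁ : IsFlowInvariantAt Z T e₁ β₁ z) (hf₂ : IsFlowInvariantAt Z T e₂ β₂ z)
    (hf₃ : IsFlowInvariantAt Z T (-e₁) (-β₁) z) (hf₄ : IsFlowInvariantAt Z T (-e₂) (-β₂) z)
    (hz : z ∈ Z) (hc : β₂ e₁ - β₁ e₂ ≠ 0) :
    ∀ᶠ s : ℝ in 𝓝 0, 0 ≤ s * (β₂ e₁ - β₁ e₂) → z + s • T ∈ Z := by
  set c := β₂ e₁ - β₁ e₂ with hcdef
  have key : ∀ᶠ t : ℝ in 𝓝 0, 0 ≤ t → z + (t ^ 2 * c) • T ∈ Z := by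
    let z₁ : ℝ → E := fun t => z + t • (e₁ + β₁ z • T)
    let z₂ : ℝ → E := fun t => z₁ t + t • (e₂ + β₂ (z₁ t) • T)
    let z₃ : ℝ → E := fun t => z₂ t + t • (-e₁ + (-β₁) (z₂ t) • T)
    have c₀ : ContinuousAt (fun t : ℝ => (z, t)) 0 := by fun_prop
    have c₁ : ContinuousAt (fun t : ℝ => (z₁ t, t)) 0 := by fun_prop
    have c₂ : ContinuousAt (fun t : ℝ => (z₂ t, t)) 0 := by fun_prop
    have c₃ : ContinuousAt (fun t : ℝ => (z₃ t, t)) 0 := by fun_prop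
    have t₁ : Filter.Tendsto (fun t : ℝ => (z₁ t, t)) (𝓝 0) (𝓝 (z, 0)) := by
      simpa [z₁] using c₁.tendsto
    have t₂ : Filter.Tendsto (fun t : ℝ => (z₂ t, t)) (𝓝 0) (𝓝 (z, 0)) := by
      simpa [z₂, z₁] using c₂.tendsto
    have t₃ : Filter.Tendsto (fun t : ℝ => (z₃ t, t)) (𝓝 0) (𝓝 (z, 0)) := by
      simpa [z₃, z₂, z₁] using c₃.tendsto
    filter_upwards [c₀.tendsto.eventually hf₁, t₁.eventually hf₂, t₂.eventually hf₃,
      t₃.eventually hf₄] with t a₁ a₂ a₃ a₄ ht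
    -- The coefficients are linear, so the four segments compose exactly to a shift by t²c along
    -- `T`, with no error term.
    have := a₄ (a₃ (a₂ (a₁ hz ht) ht) ht) ht
    convert this using 1
    simp only [z₃, z₂, z₁, map_add, map_smul, map_neg, neg_apply,
      h11, h22, h1T, h2T, smul_eq_mul, hcdef]
    module
  have hs : Filter.Tendsto (fun s : ℝ => Real.sqrt (s / c)) (𝓝 0) (𝓝 0) := by
    have : ContinuousAt (fun s : ℝ => Real.sqrt (s / c)) 0 := by fun_prop
    simpa using this.tendsto
  filter_upwards [hs.eventually key] with s h1 h2
  have h3 := h1 (Real.sqrt_nonneg _)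
  have h4 : 0 ≤ s / c := by
    have : s / c = s * c / c ^ 2 := by field_simp
    rw [this]
    positivity
  rwa [Real.sq_sqrt h4, div_mul_cancel₀ _ hc] at h3

/-- Restricted to the line, g has a local minimum at parameter 0. Both signs of s are needed for its
derivative to vanish. -/
theorem isTangentAt_of_eventually_add_smul_mem {Z : Set E} {T z : E}
    (h : ∀ᶠ s : ℝ in 𝓝 0, z + s • T ∈ Z) : IsTangentAt Z z T := fun g hg hm => by
  have hd : HasDerivAt (fun s : ℝ => z + s • T) T 0 := by
    simpa using ((hasDerivAt_id (0 : ℝ)).smul_const T).const_add z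
  have hc : Filter.Tendsto (fun s : ℝ => z + s • T) (𝓝 0) (𝓝 z) := by
    simpa using hd.continuousAt.tendsto
  have hmin : IsLocalMin (g ∘ fun s : ℝ => z + s • T) 0 := by
    filter_upwards [h, hc.eventually hm] with s h1 h2
    simpa using h2 h1
  have hg' : HasFDerivAt g (fderiv ℝ g z) (z + (0 : ℝ) • T) := by
    simpa using ((hg.differentiable (by simp)) z).hasFDerivAt
  exact hmin.hasDerivAt_eq_zero (hg'.comp_hasDerivAt 0 hd)

variable [FiniteDimensional ℝ E]

/-- A relatively closed set is invariant under the flow of a tangent field with straight integral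
curves. -/
theorem isFlowInvariantAt_of_isTangentAt {U Z : Set E} (hU : IsOpen U)
    (hZ : ∀ K ⊆ U, IsCompact K → IsCompact (K ∩ Z)) {T e : E} {β l : E →L[ℝ] ℝ}
    (hβe : β e = 0) (hβT : β T = 0) (hle : l e = 1) (hlT : l T = 0)
    (htan : ∀ z ∈ U, z ∈ Z → IsTangentAt Z z (e + β z • T)) {p : E} (hp : p ∈ U) :
    IsFlowInvariantAt Z T e β p := by
  let F := EuclideanSpace ℝ (Fin (Module.finrank ℝ E))
  let L : E ≃L[ℝ] F := toEuclidean
  let Ψ : E × ℝ × F → E := fun q =>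
    q.1 + L.symm q.2.2 + q.2.1 • (e + β (q.1 + L.symm q.2.2) • T)
  have hΨ : Continuous Ψ := by fun_prop
  have hΨU : Ψ ⁻¹' U ∈ 𝓝 (p, (0 : ℝ), (0 : F)) :=
    (hU.preimage hΨ).mem_nhds (by simpa [Ψ] using hp)
  obtain ⟨r, hr, hrU⟩ := Metric.mem_nhds_iff.1 hΨU
  filter_upwards [Metric.ball_mem_nhds (p, (0 : ℝ)) hr] with ⟨z, t⟩ hzt hz ht
  dsimp only at hz ht ⊢
  have hzp : dist z p < r := (le_max_left _ _).trans_lt hzt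
  have htr : t < r := by
    have h1 : dist t 0 < r := (le_max_right _ _).trans_lt hzt
    rw [Real.dist_eq, sub_zero] at h1
    exact (le_abs_self t).trans_lt h1
  -- `s` is the time along the flow and `π` the offset from z, at time 0, of the integral line
  -- through y. That offset is constant along each line.
  let s : E → ℝ := fun y => l (y - z)
  let π : E → F := fun y => L (y - z - s y • (e + β y • T))
  have hs : ContDiff ℝ 2 s := by fun_prop
  have hπ : ContDiff ℝ 2 π := by fun_prop
  have hsπ : ∀ y, Ψ (z, s y, π y) = y := by
    intro y
    have h1 : z + L.symm (π y) = y - s y • (e + β y • T) := by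
      simp only [π, ContinuousLinearEquiv.symm_apply_apply]
      abel
    have h2 : β (z + L.symm (π y)) = β y := by
      rw [h1]
      simp [hβe, hβT]
    simp only [Ψ, h2]
    rw [h1]
    abel
  let K : ℝ → Set E := fun δ => {y | 0 ≤ s y ∧ s y ≤ t ∧ ‖π y‖ ≤ δ}
  have hKc : ∀ δ, IsCompact (K δ) := by
    intro δ
    have h1 : IsCompact ((fun q : ℝ × F => Ψ (z, q)) '' (Set.Icc 0 t ×ˢ Metric.closedBall 0 δ)) :=
      (isCompact_Icc.prod (isCompact_closedBall _ _)).image (by fun_prop)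
    refine h1.of_isClosed_subset ?_ ?_
    · exact (isClosed_le continuous_const hs.continuous).inter
        ((isClosed_le hs.continuous continuous_const).inter
          (isClosed_le hπ.continuous.norm continuous_const))
    · rintro y ⟨h2, h3, h4⟩
      exact ⟨(s y, π y), ⟨⟨h2, h3⟩, by simpa using h4⟩, hsπ y⟩
  have hKU : ∀ δ < r, K δ ⊆ U := by
    rintro δ hδ y ⟨h2, h3, h4⟩
    have : (z, s y, π y) ∈ Metric.ball (p, (0 : ℝ), (0 : F)) r := by
      rw [Metric.mem_ball, Prod.dist_eq, Prod.dist_eq, max_lt_iff, max_lt_iff]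
      refine ⟨hzp, ?_, ?_⟩
      · rw [Real.dist_eq, sub_zero, abs_of_nonneg h2]
        exact h3.trans_lt htr
      · rw [dist_zero_right]
        exact h4.trans_lt hδ
    simpa [hsπ] using hrU this
  by_contra hnot
  -- If the line from z ends outside Z, compactness keeps the points of Z at time t a distance δ₁
  -- away from it.
  have hpos : ∀ y ∈ K (r / 2) ∩ Z ∩ {y | s y = t}, 0 < ‖π y‖ := by
    rintro y ⟨⟨-, hyZ⟩, hst⟩
    rw [norm_pos_iff]
    intro h0
    have h1 := hsπ y
    rw [h0, show s y = t from hst] at h1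
    simp only [Ψ, map_zero, add_zero] at h1
    exact hnot (h1 ▸ hyZ)
  obtain ⟨δ₁, hδ₁, hδ₁'⟩ := (((hZ _ (hKU _ (by linarith)) (hKc (r / 2))).inter_right
    (isClosed_eq hs.continuous continuous_const))).exists_forall_le' hπ.continuous.norm.continuousOn
      hpos
  obtain ⟨δ, hδ, hδr, hδδ⟩ : ∃ δ : ℝ, 0 < δ ∧ δ ≤ r / 2 ∧ δ < δ₁ :=
    ⟨min (r / 2) (δ₁ / 2), by positivity, min_le_left _ _,
      (min_le_right _ _).trans_lt (by linarith)⟩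
  -- On the lateral boundary ‖π‖ = δ this gives g = t + 1 - s > 0 = g z, so the minimum over the
  -- tube is not attained there.
  let c : ℝ := (t + 1) / δ ^ 2
  have hc : 0 < c := by positivity
  let g : E → ℝ := fun y => c * ‖π y‖ ^ 2 - s y
  have hg : ContDiff ℝ 2 g := (contDiff_const.mul (hπ.norm_sq ℝ)).sub hs
  have hsz : s z = 0 := by simp [s]
  have hπz : π z = 0 := by simp [π, hsz]
  have hzK : z ∈ K δ ∩ Z := ⟨⟨hsz.ge, hsz.le.trans ht, by simp [hπz, hδ.le]⟩, hz⟩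
  obtain ⟨y, ⟨⟨hy0, hyt, hyδ⟩, hyZ⟩, hymin⟩ :=
    (hZ _ (hKU δ (by linarith)) (hKc δ)).exists_isMinOn ⟨z, hzK⟩ hg.continuous.continuousOn
  have hyU : y ∈ U := hKU δ (by linarith) ⟨hy0, hyt, hyδ⟩
  have hgy : g y ≤ 0 := by
    have h1 : g y ≤ g z := hymin hzK
    simpa [g, hsz, hπz] using h1
  have hst : s y < t := lt_of_le_of_ne hyt fun h =>
    absurd (hδ₁' y ⟨⟨⟨hy0, hyt, hyδ.trans hδr⟩, hyZ⟩, h⟩) (not_le.2 (hyδ.trans_lt hδδ))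
  have hπδ : ‖π y‖ < δ := by
    refine lt_of_le_of_ne hyδ fun h => ?_
    simp only [g, c, h] at hgy
    rw [div_mul_cancel₀ _ (by positivity)] at hgy
    linarith
  have hmin : ∀ᶠ y' in 𝓝 y, y' ∈ Z → g y ≤ g y' := by
    filter_upwards [hs.continuous.continuousAt.eventually_lt continuousAt_const hst,
      hπ.continuous.norm.continuousAt.eventually_lt continuousAt_const hπδ] with y' h1 h2 h3
    rcases le_or_gt 0 (s y') with h4 | h4
    · exact hymin ⟨⟨h4, h1.le, h2.le⟩, h3⟩
    · have : 0 ≤ c * ‖π y'‖ ^ 2 := by positivity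
      simp only [g] at hgy ⊢
      linarith
  have h0 := htan y hyU hyZ g hg hmin
  set V := e + β y • T with hV
  -- At the local minimum g decreases at unit rate along the field, which contradicts tangency.
  have hline : ∀ σ : ℝ, g (y + σ • V) = g y - σ := by
    intro σ
    have hβV : β V = 0 := by simp [hV, hβe, hβT]
    have hlV : l V = 1 := by simp [hV, hle, hlT]
    have h1 : s (y + σ • V) = s y + σ := by
      simp only [s, map_sub, map_add, map_smul, hlV, smul_eq_mul]
      ring
    have h2 : π (y + σ • V) = π y := by
      simp only [π]
      congr 1
      rw [h1, map_add, map_smul, hβV, smul_zero, add_zero, ← hV]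
      module
    simp only [g, h1, h2]
    ring
  have hd : HasDerivAt (fun σ : ℝ => y + σ • V) V 0 := by
    simpa using ((hasDerivAt_id (0 : ℝ)).smul_const V).const_add y
  have hg' : HasFDerivAt g (fderiv ℝ g y) (y + (0 : ℝ) • V) := by
    simpa using ((hg.differentiable (by simp)) y).hasFDerivAt
  have h1 : HasDerivAt (fun σ : ℝ => g (y + σ • V)) (fderiv ℝ g y V) 0 :=
    HasFDerivAt.comp_hasDerivAt (f := fun σ : ℝ => y + σ • V) (0 : ℝ) hg' hd
  have h2 : HasDerivAt (fun σ : ℝ => g (y + σ • V)) (-1) 0 := by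
    simp only [hline]
    simpa using (hasDerivAt_id (0 : ℝ)).const_sub (g y)
  have := h1.unique h2
  linarith

/-- Two fields with straight integral curves that are tangent to `Z` and do not commute generate
a third tangent field. -/
theorem isTangentAt_commutator {U Z : Set E} (hU : IsOpen U)
    (hZ : ∀ K ⊆ U, IsCompact K → IsCompact (K ∩ Z)) {T e₁ e₂ : E} {β₁ β₂ l₁ l₂ : E →L[ℝ] ℝ}
    (h11 : β₁ e₁ = 0) (h22 : β₂ e₂ = 0) (h1T : β₁ T = 0) (h2T : β₂ T = 0)
    (hl₁ : l₁ e₁ = 1) (hl₂ : l₂ e₂ = 1) (hl₁T : l₁ T = 0) (hl₂T : l₂ T = 0)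
    (hc : β₂ e₁ - β₁ e₂ ≠ 0)
    (htan₁ : ∀ z ∈ U, z ∈ Z → IsTangentAt Z z (e₁ + β₁ z • T))
    (htan₂ : ∀ z ∈ U, z ∈ Z → IsTangentAt Z z (e₂ + β₂ z • T)) {z : E} (hz : z ∈ U)
    (hzZ : z ∈ Z) : IsTangentAt Z z T := by
  have neg : ∀ {e : E} {β l : E →L[ℝ] ℝ}, β e = 0 → β T = 0 → l e = 1 → l T = 0 →
      (∀ z ∈ U, z ∈ Z → IsTangentAt Z z (e + β z • T)) → IsFlowInvariantAt Z T (-e) (-β) z := by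
    intro e β l h1 h2 h3 h4 h5
    refine isFlowInvariantAt_of_isTangentAt (l := -l) hU hZ ?_ ?_ ?_ ?_ (fun y hy hyZ => ?_) hz
    · simp [h1]
    · simp [h2]
    · simp [h3]
    · simp [h4]
    · have h6 : -e + (-β) y • T = (-1 : ℝ) • (e + β y • T) := by
        rw [neg_apply]
        module
      rw [h6]
      exact (h5 y hy hyZ).smul _
  have f₁ := isFlowInvariantAt_of_isTangentAt hU hZ h11 h1T hl₁ hl₁T htan₁ hz
  have f₂ := isFlowInvariantAt_of_isTangentAt hU hZ h22 h2T hl₂ hl₂T htan₂ hz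
  have f₃ := neg h11 h1T hl₁ hl₁T htan₁
  have f₄ := neg h22 h2T hl₂ hl₂T htan₂
  have a := f₁.eventually_add_smul_mem h11 h22 h1T h2T f₂ f₃ f₄ hzZ hc
  -- Reversing the order of the flows changes the sign of the commutator and reaches the other half
  -- of the line.
  have b := f₂.eventually_add_smul_mem h22 h11 h2T h1T f₁ f₄ f₃ hzZ
    (by rwa [← neg_ne_zero, neg_sub])
  refine isTangentAt_of_eventually_add_smul_mem ?_
  filter_upwards [a, b] with s ha hb
  rcases le_total 0 (s * (β₂ e₁ - β₁ e₂)) with h | h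
  · exact ha h
  · exact hb (by linarith)

/-- A relatively closed set without normals is open. -/
theorem eventually_mem_of_isTangentAt {U Z : Set E} (hU : IsOpen U)
    (hZ : ∀ K ⊆ U, IsCompact K → IsCompact (K ∩ Z))
    (htan : ∀ z ∈ U, z ∈ Z → ∀ V, IsTangentAt Z z V) {p : E} (hp : p ∈ U) (hpZ : p ∈ Z) :
    ∀ᶠ y in 𝓝 p, y ∈ Z := by
  let L : E ≃L[ℝ] EuclideanSpace ℝ (Fin (Module.finrank ℝ E)) := toEuclidean
  have hLU : L.symm ⁻¹' U ∈ 𝓝 (L p) :=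
    (hU.preimage L.symm.continuous).mem_nhds (by simpa using hp)
  obtain ⟨r, hr, hrU⟩ := Metric.nhds_basis_closedBall.mem_iff.1 hLU
  let K : Set E := L ⁻¹' Metric.closedBall (L p) r
  have hKc : IsCompact K := L.toHomeomorph.isCompact_preimage.2 (isCompact_closedBall _ _)
  have hKU : K ⊆ U := fun y hy => by simpa using hrU hy
  have hnear : L ⁻¹' Metric.ball (L p) (r / 2) ∈ 𝓝 p :=
    L.continuous.continuousAt.preimage_mem_nhds (Metric.ball_mem_nhds _ (by positivity))
  filter_upwards [hnear] with q hq
  by_contra hqZ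
  let g : E → ℝ := fun y => ‖L (y - q)‖ ^ 2
  have hg : ContDiff ℝ 2 g := (L.contDiff.comp (contDiff_id.sub contDiff_const)).norm_sq ℝ
  have hpK : p ∈ K ∩ Z := ⟨Metric.mem_closedBall_self hr.le, hpZ⟩
  obtain ⟨y, ⟨hyK, hyZ⟩, hymin⟩ :=
    (hZ K hKU hKc).exists_isMinOn ⟨p, hpK⟩ hg.continuous.continuousOn
  have hq' : ‖L (p - q)‖ < r / 2 := by
    rw [map_sub, ← dist_eq_norm, dist_comm]
    exact hq
  have hyq : ‖L (y - q)‖ ≤ ‖L (p - q)‖ :=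
    le_of_sq_le_sq (hymin hpK : g y ≤ g p) (norm_nonneg _)
  -- Since q is within r/2 of p, the point of Z nearest to q is interior to `K`. Then y - q is a
  -- normal at y, and it must vanish.
  have hyball : L y ∈ Metric.ball (L p) r := by
    rw [Metric.mem_ball, dist_eq_norm]
    calc ‖L y - L p‖ = ‖L (y - q) - L (p - q)‖ := by rw [← map_sub, ← map_sub]; congr 2; abel
      _ ≤ ‖L (y - q)‖ + ‖L (p - q)‖ := norm_sub_le _ _
      _ < r := by linarith
  have hmin : ∀ᶠ y' in 𝓝 y, y' ∈ Z → g y ≤ g y' := by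
    filter_upwards [L.continuous.continuousAt.preimage_mem_nhds
      (Metric.isOpen_ball.mem_nhds hyball)] with y' h1 h2
    exact hymin ⟨Metric.ball_subset_closedBall h1, h2⟩
  have h0 := htan y (hKU hyK) hyZ (y - q) g hg hmin
  have h1 : HasFDerivAt g _ y :=
    (L.hasFDerivAt.comp y ((hasFDerivAt_id y).sub_const q)).norm_sq
  rw [h1.fderiv] at h0
  have h2 : inner ℝ (L y - L q) (L y - L q) = 0 := by
    rw [inner_sub_left, sub_eq_zero]
    simpa [inner_sub_left, sub_eq_zero] using h0
  have : y = q := by simpa [sub_eq_zero] using h2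
  exact hqZ (this ▸ hyZ)

end TangentFields
-- The frame of an intrinsic graph and the ellipticity of its curvature operator
namespace IntrinsicGraph

variable {m : ℕ}

/-- The constant horizontal part of `field`. -/
def baseDir : Fin m ⊕ Fin (m + 1) → GraphParam m
  | Sum.inl j => (Pi.single j 1, 0, 0)
  | Sum.inr k => (0, Pi.single k 1, 0)

/-- The coordinate vector field `∂/∂τ`. -/
def vertical : GraphParam m := (0, 0, 1)

/-- The `∂/∂τ`-component of `field`, as a linear function of the point and the value `u p`. -/
def verticalCoeff : Fin m ⊕ Fin (m + 1) → GraphParam m × ℝ →L[ℝ] ℝ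
  | Sum.inl j => (ContinuousLinearMap.proj (R := ℝ) (φ := fun _ : Fin (m + 1) => ℝ) j.succ).comp
      ((ContinuousLinearMap.fst ℝ _ _).comp
        ((ContinuousLinearMap.snd ℝ _ _).comp (ContinuousLinearMap.fst ℝ _ _)))
  | Sum.inr k => Fin.cases ((-2 : ℝ) • ContinuousLinearMap.snd ℝ (GraphParam m) ℝ)
      (fun j => -(ContinuousLinearMap.proj (R := ℝ) (φ := fun _ : Fin m => ℝ) j).comp
        ((ContinuousLinearMap.fst ℝ _ _).comp (ContinuousLinearMap.fst ℝ (GraphParam m) ℝ))) k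

@[simp] theorem verticalCoeff_inl (j : Fin m) (q : GraphParam m × ℝ) :
    verticalCoeff (Sum.inl j) q = q.1.2.1 j.succ := rfl

@[simp] theorem verticalCoeff_inr_zero (q : GraphParam m × ℝ) :
    verticalCoeff (Sum.inr 0) q = -2 * q.2 := rfl

@[simp] theorem verticalCoeff_inr_succ (j : Fin m) (q : GraphParam m × ℝ) :
    verticalCoeff (Sum.inr j.succ) q = -q.1.1 j := rfl

/-- The value of `field` at a point where the function takes a given value. -/
def frameAt (i : Fin m ⊕ Fin (m + 1)) (q : GraphParam m × ℝ) : GraphParam m :=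
  baseDir i + verticalCoeff i q • vertical

theorem field_eq_frameAt (u : GraphParam m → ℝ) (i : Fin m ⊕ Fin (m + 1)) (p : GraphParam m) :
    field u i p = frameAt i (p, u p) := by
  rcases i with j | k
  · simp [field, frameAt, baseDir, vertical]
  · refine Fin.cases ?_ (fun j => ?_) k <;> simp [field, frameAt, baseDir, vertical]

/-- The quasilinear expression `∑ (δ_ik σ² - ξ_i ξ_k) N_ik / σ³` with `σ² = 1 + |ξ|²`. -/
def ellipticForm {ι : Type*} [Fintype ι] (ξ : ι → ℝ) (N : ι → ι → ℝ) : ℝ :=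
  (∑ i, N i i) / Real.sqrt (1 + ∑ k, ξ k ^ 2) -
    (∑ i, ∑ k, ξ i * ξ k * N i k) / Real.sqrt (1 + ∑ k, ξ k ^ 2) ^ 3

theorem ellipticForm_add {ι : Type*} [Fintype ι] (ξ : ι → ℝ) (M N : ι → ι → ℝ) :
    ellipticForm ξ (fun i k => M i k + N i k) = ellipticForm ξ M + ellipticForm ξ N := by
  simp only [ellipticForm, mul_add, Finset.sum_add_distrib]
  ring

theorem ellipticForm_const_mul {ι : Type*} [Fintype ι] (ξ : ι → ℝ) (c : ℝ) (N : ι → ι → ℝ) :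
    ellipticForm ξ (fun i k => c * N i k) = c * ellipticForm ξ N := by
  have h : ∀ i k, ξ i * ξ k * (c * N i k) = c * (ξ i * ξ k * N i k) := fun i k => by ring
  simp only [ellipticForm, h, ← Finset.mul_sum]
  ring

/-- Lagrange's form of Cauchy–Schwarz: summing N ≥ 0 over the vectors ξ_i X_k - ξ_k X_i gives ∑ ξ_i
ξ_k N(X_i, X_k) ≤ |ξ|² ∑ N(X_i, X_i). As σ² - |ξ|² = 1, one copy of the trace remains. This strict
ellipticity along the frame is what makes Hopf's lemma annihilate every X_i g. -/
theorem sum_div_le_ellipticForm {ι E : Type*} [Fintype ι] [NormedAddCommGroup E] [NormedSpace ℝ E]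
    (ξ : ι → ℝ) (X : ι → E) (N : E →L[ℝ] E →L[ℝ] ℝ) (hN : ∀ y, 0 ≤ N y y) :
    (∑ i, N (X i) (X i)) / Real.sqrt (1 + ∑ k, ξ k ^ 2) ^ 3 ≤
      ellipticForm ξ (fun i k => N (X i) (X k)) := by
  have hpos : 0 < 1 + ∑ k, ξ k ^ 2 := by positivity
  have h1 : 0 ≤ ∑ i, ∑ k, N (ξ i • X k - ξ k • X i) (ξ i • X k - ξ k • X i) :=
    Finset.sum_nonneg fun i _ => Finset.sum_nonneg fun k _ => hN _
  have h2 : ∑ i, ∑ k, N (ξ i • X k - ξ k • X i) (ξ i • X k - ξ k • X i) =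
      2 * ((∑ k, ξ k ^ 2) * ∑ i, N (X i) (X i)) - 2 * ∑ i, ∑ k, ξ i * ξ k * N (X i) (X k) := by
    have e : ∀ i k, N (ξ i • X k - ξ k • X i) (ξ i • X k - ξ k • X i) =
        ξ i ^ 2 * N (X k) (X k) + ξ k ^ 2 * N (X i) (X i) - ξ i * ξ k * N (X i) (X k) -
          ξ k * ξ i * N (X k) (X i) := fun i k => by
      simp only [map_sub, map_smul, sub_apply, smul_apply,
        smul_eq_mul]
      ring
    simp only [e, Finset.sum_sub_distrib, Finset.sum_add_distrib]
    rw [Finset.sum_comm (f := fun i k => ξ k ^ 2 * N (X i) (X i)),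
      Finset.sum_comm (f := fun i k => ξ k * ξ i * N (X k) (X i)), ← Finset.sum_mul_sum]
    ring
  set σ := Real.sqrt (1 + ∑ k, ξ k ^ 2) with hσ
  have hσpos : 0 < σ := Real.sqrt_pos.2 hpos
  have hσ2 : σ ^ 2 = 1 + ∑ k, ξ k ^ 2 := Real.sq_sqrt hpos.le
  have h3 : ellipticForm ξ (fun i k => N (X i) (X k)) =
      (σ ^ 2 * (∑ i, N (X i) (X i)) - ∑ i, ∑ k, ξ i * ξ k * N (X i) (X k)) / σ ^ 3 := by
    simp only [ellipticForm, ← hσ]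
    field_simp
  rw [h3, hσ2]
  gcongr
  linarith

variable (m) in
/-- First-order jets of functions: point, value and derivative. -/
abbrev Jet : Type := GraphParam m × ℝ × (GraphParam m →L[ℝ] ℝ)

/-- The leading part of `curvatureOp`. -/
def leadingPart (x : Jet m) (M : GraphParam m →L[ℝ] GraphParam m →L[ℝ] ℝ) : ℝ :=
  ellipticForm (fun i => x.2.2 (frameAt i (x.1, x.2.1)))
    (fun i k => M (frameAt i (x.1, x.2.1)) (frameAt k (x.1, x.2.1)))

/-- The operator `curvatureOp` as a function of the 2-jet. -/
def jetOp (x : Jet m) (M : GraphParam m →L[ℝ] GraphParam m →L[ℝ] ℝ) : ℝ :=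
  leadingPart x M + ellipticForm (fun i => x.2.2 (frameAt i (x.1, x.2.1)))
    (fun i k => verticalCoeff k (frameAt i (x.1, x.2.1), x.2.2 (frameAt i (x.1, x.2.1))) *
      x.2.2 vertical)

theorem leadingPart_add (x : Jet m) (M N : GraphParam m →L[ℝ] GraphParam m →L[ℝ] ℝ) :
    leadingPart x (M + N) = leadingPart x M + leadingPart x N :=
  ellipticForm_add _ _ _

theorem leadingPart_smul (x : Jet m) (c : ℝ) (M : GraphParam m →L[ℝ] GraphParam m →L[ℝ] ℝ) :
    leadingPart x (c • M) = c * leadingPart x M :=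
  ellipticForm_const_mul _ _ _

theorem jetOp_add (x : Jet m) (M N : GraphParam m →L[ℝ] GraphParam m →L[ℝ] ℝ) :
    jetOp x (M + N) = jetOp x M + leadingPart x N := by
  rw [jetOp, jetOp, leadingPart_add]
  ring

theorem leadingPart_nonneg (x : Jet m) (N : GraphParam m →L[ℝ] GraphParam m →L[ℝ] ℝ)
    (hN : ∀ y, 0 ≤ N y y) : 0 ≤ leadingPart x N := by
  refine le_trans ?_ (sum_div_le_ellipticForm _ _ N hN)
  have : 0 ≤ ∑ i, N (frameAt i (x.1, x.2.1)) (frameAt i (x.1, x.2.1)) :=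
    Finset.sum_nonneg fun i _ => hN _
  positivity

theorem contDiff_ellipticForm {ι E : Type*} [Fintype ι] [NormedAddCommGroup E] [NormedSpace ℝ E]
    {n : WithTop ℕ∞} {ξ : E → ι → ℝ} {N : E → ι → ι → ℝ} (hξ : ∀ i, ContDiff ℝ n fun x => ξ x i)
    (hN : ∀ i k, ContDiff ℝ n fun x => N x i k) :
    ContDiff ℝ n fun x => ellipticForm (ξ x) (N x) := by
  have hpos : ∀ x, 0 < 1 + ∑ k, ξ x k ^ 2 := fun x => by positivity
  have hσ : ContDiff ℝ n fun x => Real.sqrt (1 + ∑ k, ξ x k ^ 2) :=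
    (contDiff_const.add (ContDiff.sum fun i _ => (hξ i).pow 2)).sqrt fun x => (hpos x).ne'
  have hσ0 : ∀ x, Real.sqrt (1 + ∑ k, ξ x k ^ 2) ≠ 0 := fun x => (Real.sqrt_pos.2 (hpos x)).ne'
  exact ((ContDiff.sum fun i _ => hN i i).div hσ hσ0).sub
    ((ContDiff.sum fun i _ => ContDiff.sum fun k _ => ((hξ i).mul (hξ k)).mul (hN i k)).div
      (hσ.pow 3) fun x => pow_ne_zero 3 (hσ0 x))

theorem contDiff_frameAt {n : WithTop ℕ∞} (i : Fin m ⊕ Fin (m + 1)) :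
    ContDiff ℝ n (frameAt (m := m) i) :=
  ContDiff.add (f := fun _ => baseDir i) contDiff_const
    ((verticalCoeff i).contDiff.smul contDiff_const)

theorem contDiff_leadingPart {n : WithTop ℕ∞} :
    ContDiff ℝ n (Function.uncurry (leadingPart (m := m))) := by
  have hX : ∀ i, ContDiff ℝ n fun y : Jet m × (GraphParam m →L[ℝ] GraphParam m →L[ℝ] ℝ) =>
      frameAt i (y.1.1, y.1.2.1) := fun i => (contDiff_frameAt i).comp (by fun_prop)
  have hl : ∀ i, ContDiff ℝ n fun y : Jet m × (GraphParam m →L[ℝ] GraphParam m →L[ℝ] ℝ) =>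
      y.1.2.2 (frameAt i (y.1.1, y.1.2.1)) := fun i => ContDiff.clm_apply (by fun_prop) (hX i)
  exact contDiff_ellipticForm hl fun i k => (contDiff_snd.clm_apply (hX i)).clm_apply (hX k)

theorem contDiff_jetOp {n : WithTop ℕ∞} :
    ContDiff ℝ n (Function.uncurry (jetOp (m := m))) := by
  have hX : ∀ i, ContDiff ℝ n fun y : Jet m × (GraphParam m →L[ℝ] GraphParam m →L[ℝ] ℝ) =>
      frameAt i (y.1.1, y.1.2.1) := fun i => (contDiff_frameAt i).comp (by fun_prop)
  have hl : ∀ i, ContDiff ℝ n fun y : Jet m × (GraphParam m →L[ℝ] GraphParam m →L[ℝ] ℝ) =>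
      y.1.2.2 (frameAt i (y.1.1, y.1.2.1)) := fun i => ContDiff.clm_apply (by fun_prop) (hX i)
  refine contDiff_leadingPart.add (contDiff_ellipticForm hl fun i k => ?_)
  exact ((verticalCoeff k).contDiff.comp ((hX i).prodMk (hl i))).mul
    (ContDiff.clm_apply (by fun_prop) contDiff_const)

/-- The field itself varies with the point and with u. Its coefficient is linear in the pair, so the
product rule contributes the second summand. -/
theorem hasFDerivAt_W {u : GraphParam m → ℝ} {p : GraphParam m} (hu : ContDiffAt ℝ 2 u p)
    (k : Fin m ⊕ Fin (m + 1)) :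
    ∃ L : GraphParam m →L[ℝ] ℝ, HasFDerivAt (W u k u) L p ∧ ∀ y, L y =
      fderiv ℝ (fderiv ℝ u) p y (frameAt k (p, u p)) +
        verticalCoeff k (y, fderiv ℝ u p y) * fderiv ℝ u p vertical := by
  have hDu : HasFDerivAt (fderiv ℝ u) (fderiv ℝ (fderiv ℝ u) p) p :=
    ((hu.fderiv_right (m := 1) (by norm_num)).differentiableAt (by simp)).hasFDerivAt
  have hu1 : HasFDerivAt u (fderiv ℝ u p) p := (hu.differentiableAt (by simp)).hasFDerivAt
  have h1 : HasFDerivAt (fun q => (q, u q)) _ p := (hasFDerivAt_id p).prodMk hu1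
  have h2 : HasFDerivAt (fun q => verticalCoeff k (q, u q)) _ p :=
    (verticalCoeff k).hasFDerivAt.comp p h1
  have h3 : HasFDerivAt (fun q => frameAt k (q, u q)) _ p :=
    (h2.smul_const (vertical (m := m))).const_add (baseDir k)
  have h4 := hDu.clm_apply h3
  refine ⟨_, h4.congr_of_eventuallyEq (Filter.Eventually.of_forall fun q => ?_), fun y => ?_⟩
  · simp only [W, field_eq_frameAt]
  · simp
    ring

/-- With ξ_i = X_i u, the quotient rule gives X_i(ξ_i/σ) = X_i ξ_i/σ - ∑_k ξ_i ξ_k X_i ξ_k/σ³, and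
the sum over i is `ellipticForm` of the matrix X_i ξ_k. -/
theorem curvatureOp_eq_jetOp {u : GraphParam m → ℝ} {p : GraphParam m} (hu : ContDiffAt ℝ 2 u p) :
    curvatureOp u p = jetOp (p, u p, fderiv ℝ u p) (fderiv ℝ (fderiv ℝ u) p) := by
  choose L hL hLy using hasFDerivAt_W hu
  have hpos : 0 < 1 + ∑ k, W u k u p ^ 2 := by positivity
  set σ := Real.sqrt (1 + ∑ k, W u k u p ^ 2) with hσ
  have hσpos : 0 < σ := Real.sqrt_pos.2 hpos
  have hσ' : HasFDerivAt (fun q => Real.sqrt (1 + ∑ k, W u k u q ^ 2)) _ p :=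
    ((HasFDerivAt.fun_sum fun k (_ : k ∈ Finset.univ) => (hL k).pow 2).const_add 1).sqrt hpos.ne'
  have hterm : ∀ i, W u i (fun q => W u i u q / Real.sqrt (1 + ∑ k, W u k u q ^ 2)) p =
      L i (frameAt i (p, u p)) / σ -
        (∑ k, W u i u p * W u k u p * L k (frameAt i (p, u p))) / σ ^ 3 := by
    intro i
    have h : HasFDerivAt (fun q => W u i u q / Real.sqrt (1 + ∑ k, W u k u q ^ 2)) _ p :=
      (hL i).mul ((hasDerivAt_inv hσpos.ne').comp_hasFDerivAt p hσ')
    rw [W, h.fderiv, field_eq_frameAt]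
    simp only [← hσ, add_apply, smul_apply, sum_apply, smul_eq_mul, nsmul_eq_mul, pow_one,
      Nat.add_one_sub_one, Nat.cast_ofNat]
    have h2 : ∑ k, W u i u p * W u k u p * L k (frameAt i (p, u p)) =
        W u i u p * ∑ k, W u k u p * L k (frameAt i (p, u p)) := by
      simp only [Finset.mul_sum, mul_assoc]
    have h3 : ∑ k, 2 * W u k u p * L k (frameAt i (p, u p)) =
        2 * ∑ k, W u k u p * L k (frameAt i (p, u p)) := by
      simp only [Finset.mul_sum, mul_assoc]
    rw [h2, h3]
    field_simp
    ring
  have hWp : ∀ i, W u i u p = fderiv ℝ u p (frameAt i (p, u p)) := fun i => by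
    rw [W, field_eq_frameAt]
  rw [jetOp, leadingPart, ← ellipticForm_add]
  simp only [curvatureOp, hterm, Finset.sum_sub_distrib, ← Finset.sum_div, ellipticForm, hσ, hWp,
    hLy]

/-- Hopf's lemma bounds the leading part on Dg ⊗ Dg above by 0, while ellipticity bounds it below by
∑ (X_i g)²/σ³. Hence every X_i g vanishes. -/
theorem isTangentAt_frameAt {U : Set (GraphParam m)} (hU : IsOpen U) {u v : GraphParam m → ℝ}
    (hu : ContDiffOn ℝ 2 u U) (hv : ContDiffOn ℝ 2 v U) (hle : ∀ p ∈ U, u p ≤ v p)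
    (hcurv : ∀ p ∈ U, curvatureOp v p ≤ curvatureOp u p) {z : GraphParam m} (hz : z ∈ U)
    (hzZ : v z = u z) (i : Fin m ⊕ Fin (m + 1)) :
    IsTangentAt {p | v p = u p} z (frameAt i (z, u z)) := by
  intro g hg hmin
  have hQ : ∀ p ∈ U, jetOp (p, v p, fderiv ℝ v p) (fderiv ℝ (fderiv ℝ v) p) ≤
      jetOp (p, u p, fderiv ℝ u p) (fderiv ℝ (fderiv ℝ u) p) := fun p hp => by
    rw [← curvatureOp_eq_jetOp (hu.contDiffAt (hU.mem_nhds hp)),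
      ← curvatureOp_eq_jetOp (hv.contDiffAt (hU.mem_nhds hp))]
    exact hcurv p hp
  have h1 := leading_part_fderiv_smulRight_nonpos (F := jetOp) (G := leadingPart) jetOp_add
    leadingPart_nonneg leadingPart_add leadingPart_smul
    (contDiff_leadingPart (n := 0)).continuous contDiff_jetOp hU hu hv hle hQ hz hzZ hg hmin
  have h2 := (sum_div_le_ellipticForm _ (fun i => frameAt i (z, u z)) _ fun y => by
    simpa using mul_self_nonneg (fderiv ℝ g z y)).trans h1
  rw [div_le_iff₀ (by positivity), zero_mul] at h2
  have h3 : ∀ k ∈ Finset.univ, (0 : ℝ) ≤ ((fderiv ℝ g z).smulRight (fderiv ℝ g z))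
      (frameAt k (z, u z)) (frameAt k (z, u z)) := fun k _ => by
    simpa using mul_self_nonneg (fderiv ℝ g z (frameAt k (z, u z)))
  have h4 := (Finset.sum_eq_zero_iff_of_nonneg h3).1 (le_antisymm h2 (Finset.sum_nonneg h3)) i
    (Finset.mem_univ i)
  simpa using h4

theorem eq_sum_baseDir (y : GraphParam m) :
    y = ∑ j, y.1 j • baseDir (Sum.inl j) + ∑ k, y.2.1 k • baseDir (Sum.inr k) +
      y.2.2 • vertical := by
  refine Prod.ext ?_ (Prod.ext ?_ ?_)
  · ext j
    simp [baseDir, vertical, Prod.fst_sum, Finset.sum_apply, Pi.single_apply]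
  · ext k
    simp [baseDir, vertical, Prod.fst_sum, Prod.snd_sum, Finset.sum_apply, Pi.single_apply]
  · simp [baseDir, vertical, Prod.snd_sum]

/-- The pair with index η², η^{n+2} has coefficients linear in the point and commutator -2∂_τ. The
field with coefficient -2u is avoided, since its integral curves need not be straight. -/
theorem isTangentAt_vertical {U Z : Set (GraphParam m)} (hm : 1 ≤ m) (hU : IsOpen U)
    (hZ : ∀ K ⊆ U, IsCompact K → IsCompact (K ∩ Z)) {u : GraphParam m → ℝ}
    (htan : ∀ z ∈ U, z ∈ Z → ∀ i, IsTangentAt Z z (frameAt i (z, u z))) {z : GraphParam m}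
    (hz : z ∈ U) (hzZ : z ∈ Z) : IsTangentAt Z z vertical := by
  let j : Fin m := ⟨0, hm⟩
  let ιE : GraphParam m →L[ℝ] GraphParam m × ℝ := ContinuousLinearMap.inl ℝ _ _
  let l₁ : GraphParam m →L[ℝ] ℝ :=
    (ContinuousLinearMap.proj (R := ℝ) (φ := fun _ : Fin m => ℝ) j).comp
      (ContinuousLinearMap.fst ℝ _ _)
  refine isTangentAt_commutator (e₁ := baseDir (Sum.inl j)) (e₂ := baseDir (Sum.inr j.succ))
    (β₁ := (verticalCoeff (Sum.inl j)).comp ιE) (β₂ := (verticalCoeff (Sum.inr j.succ)).comp ιE)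
    -- The coefficient of the first field is the coordinate η^{n+2}, which also measures time along
    -- the second.
    (l₁ := l₁) (l₂ := (verticalCoeff (Sum.inl j)).comp ιE) hU hZ
    ?_ ?_ ?_ ?_ ?_ ?_ ?_ ?_ ?_ ?_ ?_ hz hzZ
  rotate_right 2
  · intro y hy hyZ
    simpa [frameAt, ιE] using htan y hy hyZ (Sum.inl j)
  · intro y hy hyZ
    simpa [frameAt, ιE] using htan y hy hyZ (Sum.inr j.succ)
  all_goals norm_num [baseDir, vertical, ιE, l₁]

end IntrinsicGraph

end

/-- Strong maximum principle for intrinsic graphs in the Heisenberg group `H_n`, `n = m + 1 ≥ 2`. -/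
theorem theoremE (m : ℕ) (hn : 2 ≤ m + 1)
    (U : Set (GraphParam m)) (hU : IsOpen U) (p₀ : GraphParam m) (hp₀ : p₀ ∈ U)
    (u v : GraphParam m → ℝ) (hu : ContDiffOn ℝ ∞ u U) (hv : ContDiffOn ℝ ∞ v U)
    (htouch : v p₀ = u p₀)
    (hv' : IntrinsicGraph.partialEta v p₀ ≠ 0) (hu' : IntrinsicGraph.partialEta u p₀ ≠ 0)
    (hle : ∀ p ∈ U, u p ≤ v p)
    (hcurv : ∀ p ∈ U, IntrinsicGraph.curvatureOp v p ≤ IntrinsicGraph.curvatureOp u p)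
    (hconst : IntrinsicGraph.HasConstantMeanCurvature v U ∨
      IntrinsicGraph.HasConstantMeanCurvature u U) :
    ∀ᶠ p in 𝓝 p₀, v p = u p := by
  have hle2 : (2 : WithTop ℕ∞) ≤ ∞ := WithTop.coe_le_coe.2 (le_top : (2 : ℕ∞) ≤ ⊤)
  have hZ : ∀ K ⊆ U, IsCompact K → IsCompact (K ∩ {p | v p = u p}) := by
    intro K hKU hK
    have h1 : ContinuousOn (fun p => v p - u p) K :=
      (hv.continuousOn.mono hKU).sub (hu.continuousOn.mono hKU)
    have h2 := h1.preimage_isClosed_of_isClosed hK.isClosed (isClosed_singleton (x := (0 : ℝ)))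
    convert hK.of_isClosed_subset h2 Set.inter_subset_left using 2
    ext p
    simp [sub_eq_zero]
  have htan : ∀ z ∈ U, z ∈ {p | v p = u p} → ∀ i,
      IsTangentAt {p | v p = u p} z (IntrinsicGraph.frameAt i (z, u z)) := fun z hz hzZ i =>
    IntrinsicGraph.isTangentAt_frameAt hU (hu.of_le hle2) (hv.of_le hle2) hle hcurv hz hzZ i
  refine eventually_mem_of_isTangentAt hU hZ (fun z hz hzZ V => ?_) hp₀ htouch
  have hT := IntrinsicGraph.isTangentAt_vertical (by omega) hU hZ htan hz hzZ
  -- Tangency at a single point is linear, so this also covers the field with coefficient -2u,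
  -- without using its flow.
  have hbase : ∀ i, IsTangentAt {p | v p = u p} z (IntrinsicGraph.baseDir i) := fun i => by
    have := (htan z hz hzZ i).add (hT.smul (-IntrinsicGraph.verticalCoeff i (z, u z)))
    rwa [IntrinsicGraph.frameAt, neg_smul, add_neg_cancel_right] at this
  rw [IntrinsicGraph.eq_sum_baseDir V]
  exact ((IsTangentAt.sum _ fun j _ => (hbase _).smul _).add
    (IsTangentAt.sum _ fun k _ => (hbase _).smul _)).add (hT.smul _)
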